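/- For a probability distribution $D$ on $\{0,1\}^n$ and functions $f,g:\{0,1\}^n\to\{0,1\}$ let $\mathrm{dist}_D(f,g)=\Pr_{z\sim D}[f(z)\neq g(z)]$. A function $f$ is a monotone conjunction if there is a set $S\subseteq\{1,\dots,n\}$ with $f(z)=\bigwedge_{i\in S}z_i$ for all $z$ (the constant function $1$ if $S=\emptyset$), and $f$ is $\varepsilon$-far from monotone conjunctions with respect to $D$ if $\mathrm{dist}_D(f,g)\ge\varepsilon$ for every monotone conjunction $g$. A testing algorithm is a randomized adaptive algorithm that is given $n$ and $\varepsilon$ and accesses an unknown pair $(f,D)$ only by queries of two kinds: a black-box query at a string $z$ of its choice returns $f(z)$; a sampling query returns a pair $(z,f(z))$ with $z$ drawn independently from $D$. Theorem. There are a testing algorithm and an absolute constant $C$ such that for all integers $n\ge 2$ and all real $0<\varepsilon\le 1$ the algorithm makes, in the worst case, at most $$C\cdot\frac{n^{1/3}}{\varepsilon^{5}}\cdot\log^{7}(n/\varepsilon)$$ queries (of both kinds together), and for every $f:\{0,1\}^n\to\{0,1\}$ and every probability distribution $D$ on $\{0,1\}^n$: 1. (one-sided error) if $f$ is a monotone conjunction,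 it accepts with probability $1$; 2. if $f$ is $\varepsilon$-far from monotone conjunctions with respect to $D$, it rejects with probability at least $2/3$. -/

import Mathlib

open scoped ENNReal

noncomputable section

/-- Strings in the Boolean cube `{0,1}^n`. -/
abbrev Cube (n : ℕ) : Type := Fin n → Bool

/-- Boolean functions on the cube. -/
abbrev BoolFun (n : ℕ) : Type := Cube n → Bool

/-- The class of monotone conjunctions: `f z = ⋀_{i ∈ S} z_i` for some set `S` of indices
(`S = ∅` gives the constant function `1`). -/
def Mconj (n : ℕ) : Set (BoolFun n) :=
  {f | ∃ S : Finset (Fin n), ∀ z, f z = true ↔ ∀ i ∈ S, z i = true}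

/-- `dist_D(f, g) = Pr_{z ∼ D} [f z ≠ g z]`. -/
def distFun {n : ℕ} (D : PMF (Cube n)) (f g : BoolFun n) : ℝ≥0∞ :=
  ∑ z with f z ≠ g z, D z

/-- The distance from `f` to a class: the least distance from `f` to a member of the class. -/
def distClass {n : ℕ} (D : PMF (Cube n)) (f : BoolFun n) (C : Set (BoolFun n)) : ℝ≥0∞ :=
  ⨅ g ∈ C, distFun D f g

/-- `f` is `ε`-far from the class `C` with respect to `D`. -/
def IsFar {n : ℕ} (ε : ℝ) (D : PMF (Cube n)) (f : BoolFun n) (C : Set (BoolFun n)) : Prop :=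
  ENNReal.ofReal ε ≤ distClass D f C

/-- Randomized adaptive algorithms that access a pair `(f, D)` only through a black-box oracle
for `f` and a sampling oracle for `D` which returns labelled samples `(z, f z)`. -/
inductive OracleAlg (n : ℕ) : Type
  /-- Stop and accept (`true`) or reject (`false`). -/
  | halt (accept : Bool) : OracleAlg n
  /-- Query the black-box oracle on `z` and continue according to the answer. -/
  | query (z : Cube n) (next : Bool → OracleAlg n) : OracleAlg n
  /-- Ask the sampling oracle for a pair and continue according to the pair received. -/
  | sample (next : Cube n → Bool → OracleAlg n) : OracleAlg n
  /-- Internal randomness: draw a uniformly random element of `{0, …, k}`. -/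
  | random (k : ℕ) (next : Fin (k + 1) → OracleAlg n) : OracleAlg n

namespace OracleAlg

variable {n : ℕ}

/-- The distribution of the output (`true` for accept, `false` for reject) of the algorithm run
on `(f, D)`. All samples and all internal random choices are independent. -/
def run (f : BoolFun n) (D : PMF (Cube n)) : OracleAlg n → PMF Bool
  | halt accept => PMF.pure accept
  | query z next => run f D (next (f z))
  | sample next => D.bind fun z => run f D (next z (f z))
  | random k next => (PMF.uniformOfFintype (Fin (k + 1))).bind fun i => run f D (next i)

/-- The worst-case total number of calls to the two oracles; internal randomness is free. -/
def queries : OracleAlg n → ℕ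
  | halt _ => 0
  | query _ next => 1 + Finset.univ.sup fun b => queries (next b)
  | sample next => 1 + Finset.univ.sup fun z => Finset.univ.sup fun b => queries (next z b)
  | random _ next => Finset.univ.sup fun i => queries (next i)

/-- `T` is a distribution-free testing algorithm for `C` with distance parameter `ε`
(in general with two-sided error). -/
structure IsTester (T : OracleAlg n) (C : Set (BoolFun n)) (ε : ℝ) : Prop where
  accepts : ∀ f ∈ C, ∀ D : PMF (Cube n), 2 / 3 ≤ T.run f D true
  rejects : ∀ (f : BoolFun n) (D : PMF (Cube n)), IsFar ε D f C → 2 / 3 ≤ T.run f D false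

/-- `T` always accepts the functions in `C`. -/
def IsOneSided (T : OracleAlg n) (C : Set (BoolFun n)) : Prop :=
  ∀ f ∈ C, ∀ D : PMF (Cube n), T.run f D true = 1

end OracleAlg

end

/-! For `s` samples let `N_v` count the sampled `1`-strings with a zero at `v`; the random
combination has a zero at `v` with probability `N_v / m`, independently over `v`. If `f` is a
monotone conjunction, every combination is a `1`-string, and `f (singleZero i) = false` forces the
value `0` on every string with a zero at `i`. The two tests check these facts, so the error is
one-sided.

For soundness, fix `r` samples and compare `f` with the conjunction over those `i` for which the
combination with an added zero at `i` is a `1`-string with probability at most `1/16`. At a point of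
disagreement, either `certTest` rejects with probability at least `1/16`, or the point is a
`1`-string with a zero in this set (`Meets`). Hence (`isFar_le_meets_add`) `certTest` rejects with
probability at least `ε/32`, or a fresh sample meets the set with probability at least `ε/2`.

In the second case, by symmetry, each of `r + 1` samples is that likely to meet the set defined by
the others. Putting the sample back changes the product measure by an amount controlled by its
rarity, through a `χ²` comparison (`escapeProb_le_half`); rarities sum to at most `n`, so few are
large. Conditionally on a zero at the position met, the combination is then a `0`-string with
probability at least `1/2`, and a second moment bound (`card_le_of_meets`) makes `unionTest` reject.

With `s = r + 1` the constraints are `s * m ≳ n/ε` (rarity), `m ≥ 4 s²` (second moment) and `M ≥ 4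
m/s` (detection). Taking `s ≈ n^(1/3)` makes `s + M` of order `n^(1/3)/ε`; with `O(1/ε)` repetitions
the total is `O(n^(1/3)/ε²)`, below the claimed bound. -/

noncomputable section

/-! ### Acceptance probabilities and composition of algorithms -/

namespace OracleAlg

variable {n : ℕ}

/-- The probability that the algorithm accepts `(f, D)`, as a real number. -/
def acc (f : BoolFun n) (D : PMF (Cube n)) (T : OracleAlg n) : ℝ := (T.run f D true).toReal

lemma run_false_eq (f : BoolFun n) (D : PMF (Cube n)) (T : OracleAlg n) :
    T.run f D false = 1 - T.run f D true := by
  have h := (T.run f D).tsum_coe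
  rw [tsum_bool] at h
  exact ENNReal.eq_sub_of_add_eq (PMF.apply_ne_top _ _) h

lemma acc_nonneg (f : BoolFun n) (D : PMF (Cube n)) (T : OracleAlg n) : 0 ≤ acc f D T :=
  ENNReal.toReal_nonneg

lemma acc_le_one (f : BoolFun n) (D : PMF (Cube n)) (T : OracleAlg n) : acc f D T ≤ 1 := by
  have := (T.run f D).coe_le_one true
  exact ENNReal.toReal_le_of_le_ofReal zero_le_one (by simpa using this)

lemma run_true_eq_one_of_acc {f : BoolFun n} {D : PMF (Cube n)} {T : OracleAlg n}
    (h : acc f D T = 1) : T.run f D true = 1 := by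
  rw [acc, ENNReal.toReal_eq_one_iff] at h
  exact h

lemma le_run_false_of_acc {f : BoolFun n} {D : PMF (Cube n)} {T : OracleAlg n}
    (h : acc f D T ≤ 1 / 3) : 2 / 3 ≤ T.run f D false := by
  rw [run_false_eq]
  have h2 : T.run f D true ≤ 1 / 3 := by
    rw [acc] at h
    have := (ENNReal.le_ofReal_iff_toReal_le (PMF.apply_ne_top _ _) (by norm_num)).2 h
    rwa [ENNReal.ofReal_div_of_pos (by norm_num), ENNReal.ofReal_one,
      ENNReal.ofReal_ofNat] at this
  have h3 : (2 / 3 : ℝ≥0∞) = 1 - 1 / 3 := by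
    refine ENNReal.eq_sub_of_add_eq (by simp) ?_
    rw [← ENNReal.add_div]
    norm_num
    exact ENNReal.div_self (by simp) (by simp)
  rw [h3]
  exact tsub_le_tsub_left h2 _

@[simp] lemma acc_halt (f : BoolFun n) (D : PMF (Cube n)) (b : Bool) :
    acc f D (halt b) = if b then 1 else 0 := by
  cases b <;> simp [acc, run]

@[simp] lemma acc_query (f : BoolFun n) (D : PMF (Cube n)) (z : Cube n)
    (next : Bool → OracleAlg n) : acc f D (query z next) = acc f D (next (f z)) := rfl

lemma acc_sample (f : BoolFun n) (D : PMF (Cube n)) (next : Cube n → Bool → OracleAlg n) :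
    acc f D (sample next) = ∑ z, (D z).toReal * acc f D (next z (f z)) := by
  simp only [acc, run, PMF.bind_apply, tsum_fintype]
  rw [ENNReal.toReal_sum fun z _ =>
    ENNReal.mul_ne_top (PMF.apply_ne_top _ _) (PMF.apply_ne_top _ _)]
  simp

lemma acc_random (f : BoolFun n) (D : PMF (Cube n)) (k : ℕ)
    (next : Fin (k + 1) → OracleAlg n) :
    acc f D (random k next) = (∑ i, acc f D (next i)) / (k + 1 : ℕ) := by
  simp only [acc, run, PMF.bind_apply, tsum_fintype]
  rw [ENNReal.toReal_sum fun z _ =>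
    ENNReal.mul_ne_top (PMF.apply_ne_top _ _) (PMF.apply_ne_top _ _), Finset.sum_div]
  refine Finset.sum_congr rfl fun i _ => ?_
  rw [ENNReal.toReal_mul, PMF.uniformOfFintype_apply, Fintype.card_fin, ENNReal.toReal_inv,
    ENNReal.toReal_natCast, div_eq_mul_inv, mul_comm]

/-- Run the first algorithm and, if it accepts, continue with the second one. -/
def seq : OracleAlg n → OracleAlg n → OracleAlg n
  | halt b, B => if b then B else halt false
  | query z next, B => query z fun b => seq (next b) B
  | sample next, B => sample fun z b => seq (next z b) B
  | random k next, B => random k fun i => seq (next i) B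

/-- The second run uses fresh samples and randomness, so the two acceptances are independent. -/
lemma acc_seq (f : BoolFun n) (D : PMF (Cube n)) (A B : OracleAlg n) :
    acc f D (seq A B) = acc f D A * acc f D B := by
  induction A with
  | halt b => cases b <;> simp [seq]
  | query z next ih => simp [seq, ih]
  | sample next ih =>
    simp only [seq, acc_sample, ih, Finset.sum_mul]
    exact Finset.sum_congr rfl fun z _ => by ring
  | random k next ih =>
    simp only [seq, acc_random, ih, ← Finset.sum_mul]
    ring

lemma queries_seq (A B : OracleAlg n) : (seq A B).queries ≤ A.queries + B.queries := by
  induction A with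
  | halt b => cases b <;> simp [seq, queries]
  | query z next ih =>
    simp only [seq, queries, add_assoc]
    refine Nat.add_le_add_left (Finset.sup_le fun b _ => (ih b).trans ?_) 1
    exact Nat.add_le_add_right (Finset.le_sup (f := fun b => (next b).queries)
      (Finset.mem_univ b)) _
  | sample next ih =>
    simp only [seq, queries, add_assoc]
    refine Nat.add_le_add_left
      (Finset.sup_le fun z _ => Finset.sup_le fun b _ => (ih z b).trans ?_) 1
    refine Nat.add_le_add_right ?_ _
    exact (Finset.le_sup (f := fun b => (next z b).queries) (Finset.mem_univ b)).trans
      (Finset.le_sup (f := fun z => Finset.univ.sup fun b => (next z b).queries)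
        (Finset.mem_univ z))
  | random k next ih =>
    simp only [seq, queries]
    refine Finset.sup_le fun b _ => (ih b).trans ?_
    exact Nat.add_le_add_right (Finset.le_sup (f := fun b => (next b).queries)
      (Finset.mem_univ b)) _

/-- Run an algorithm `k` times and accept if all runs do. -/
def iter (A : OracleAlg n) : ℕ → OracleAlg n
  | 0 => halt true
  | k + 1 => seq A (iter A k)

lemma acc_iter (f : BoolFun n) (D : PMF (Cube n)) (A : OracleAlg n) (k : ℕ) :
    acc f D (iter A k) = acc f D A ^ k := by
  induction k with
  | zero => simp [iter]
  | succ k ih => rw [iter, acc_seq, ih, pow_succ']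

lemma queries_iter (A : OracleAlg n) (k : ℕ) : (iter A k).queries ≤ k * A.queries := by
  induction k with
  | zero => simp [iter, queries]
  | succ k ih =>
    rw [iter, add_mul, one_mul, add_comm]
    exact (queries_seq _ _).trans (Nat.add_le_add_left ih _)

/-- Draw a uniformly random element of a nonempty finite type. -/
def uniform (Ω : Type) [Fintype Ω] [Nonempty Ω] (next : Ω → OracleAlg n) : OracleAlg n :=
  random (Fintype.card Ω - 1) fun i =>
    next ((Fintype.equivFin Ω).symm (Fin.cast (Nat.sub_add_cancel Fintype.card_pos) i))

lemma acc_uniform (f : BoolFun n) (D : PMF (Cube n)) (Ω : Type) [Fintype Ω] [Nonempty Ω]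
    (next : Ω → OracleAlg n) :
    acc f D (uniform Ω next) = (∑ w, acc f D (next w)) / Fintype.card Ω := by
  have hc : Fintype.card Ω - 1 + 1 = Fintype.card Ω := Nat.sub_add_cancel Fintype.card_pos
  rw [uniform, acc_random]
  refine congrArg₂ _ ?_ (by rw [hc])
  exact Fintype.sum_equiv ((finCongr hc).trans (Fintype.equivFin Ω).symm) _ _ fun i => rfl

lemma queries_uniform_le {Ω : Type} [Fintype Ω] [Nonempty Ω] {next : Ω → OracleAlg n} {c : ℕ}
    (h : ∀ w, (next w).queries ≤ c) : (uniform Ω next).queries ≤ c := by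
  rw [uniform, queries]
  exact Finset.sup_le fun i _ => h _

lemma queries_query_le {z : Cube n} {next : Bool → OracleAlg n} {c : ℕ}
    (h : ∀ b, (next b).queries ≤ c) : (query z next).queries ≤ 1 + c := by
  rw [queries]
  exact Nat.add_le_add_left (Finset.sup_le fun b _ => h b) _

lemma queries_sample_le {next : Cube n → Bool → OracleAlg n} {c : ℕ}
    (h : ∀ z b, (next z b).queries ≤ c) : (sample next).queries ≤ 1 + c := by
  rw [queries]
  exact Nat.add_le_add_left (Finset.sup_le fun z _ => Finset.sup_le fun b _ => h z b) _

/-! ### Independent samples -/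

/-- Draw `s` labelled samples. -/
def samples : (s : ℕ) → ((Fin s → Cube n × Bool) → OracleAlg n) → OracleAlg n
  | 0, next => next Fin.elim0
  | s + 1, next => sample fun z b => samples s fun y => next (Fin.cons (z, b) y)

lemma queries_samples_le {s c : ℕ} {next : (Fin s → Cube n × Bool) → OracleAlg n}
    (h : ∀ y, (next y).queries ≤ c) : (samples s next).queries ≤ s + c := by
  induction s with
  | zero => simpa [samples] using h _
  | succ s ih =>
    have := queries_sample_le (next := fun z b => samples s fun y => next (Fin.cons (z, b) y))
      fun z b => ih fun y => h _
    rw [samples]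
    omega

/-- The expectation over `s` independent samples from `D`. -/
def expSamples (D : PMF (Cube n)) (s : ℕ) (F : (Fin s → Cube n) → ℝ) : ℝ :=
  ∑ y : Fin s → Cube n, (∏ k, (D (y k)).toReal) * F y

/-- Any one of the samples may be drawn before the others. -/
lemma expSamples_succ (D : PMF (Cube n)) (s : ℕ) (k : Fin (s + 1))
    (F : (Fin (s + 1) → Cube n) → ℝ) :
    expSamples D (s + 1) F =
      ∑ z, (D z).toReal * expSamples D s fun y => F (Fin.insertNth k z y) := by
  simp only [expSamples, Finset.mul_sum]
  rw [← Fintype.sum_prod_type', ← (Fin.insertNthEquiv (fun _ => Cube n) k).sum_comp]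
  refine Finset.sum_congr rfl fun p _ => ?_
  rw [Fin.prod_univ_succAbove _ k]
  simp [mul_assoc, Fin.insertNthEquiv]

lemma acc_samples (f : BoolFun n) (D : PMF (Cube n)) (s : ℕ)
    (next : (Fin s → Cube n × Bool) → OracleAlg n) :
    acc f D (samples s next) =
      expSamples D s fun y => acc f D (next fun k => (y k, f (y k))) := by
  induction s with
  | zero =>
    simp only [samples, expSamples, Finset.univ_unique, Finset.sum_singleton, Finset.univ_eq_empty,
      Finset.prod_empty, one_mul]
    congr 2
    exact Subsingleton.elim _ _
  | succ s ih =>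
    rw [samples, acc_sample, expSamples_succ D s 0]
    refine Finset.sum_congr rfl fun z _ => ?_
    rw [ih]
    congr 2
    funext y
    congr 2
    funext k
    refine Fin.cases ?_ (fun k => ?_) k <;> simp

lemma sum_toReal (D : PMF (Cube n)) : ∑ z, (D z).toReal = 1 := by
  rw [← ENNReal.toReal_sum fun z _ => PMF.apply_ne_top _ _, ← ENNReal.toReal_one, ← D.tsum_coe,
    tsum_fintype]

lemma expSamples_mono {D : PMF (Cube n)} {s : ℕ} {F G : (Fin s → Cube n) → ℝ}
    (h : ∀ y, F y ≤ G y) : expSamples D s F ≤ expSamples D s G :=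
  Finset.sum_le_sum fun y _ => mul_le_mul_of_nonneg_left (h y)
    (Finset.prod_nonneg fun _ _ => ENNReal.toReal_nonneg)

lemma expSamples_const (D : PMF (Cube n)) (s : ℕ) (c : ℝ) :
    expSamples D s (fun _ => c) = c := by
  induction s with
  | zero => simp [expSamples]
  | succ s ih => simp only [expSamples_succ D s 0, ih, ← Finset.sum_mul, sum_toReal, one_mul]

lemma expSamples_add (D : PMF (Cube n)) (s : ℕ) (F G : (Fin s → Cube n) → ℝ) :
    expSamples D s (fun y => F y + G y) = expSamples D s F + expSamples D s G := by
  simp only [expSamples, mul_add, Finset.sum_add_distrib]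

lemma expSamples_mul_const (D : PMF (Cube n)) (s : ℕ) (F : (Fin s → Cube n) → ℝ) (c : ℝ) :
    expSamples D s (fun y => F y * c) = expSamples D s F * c := by
  simp only [expSamples, Finset.sum_mul, mul_assoc]

lemma expSamples_sum {ι : Type*} (t : Finset ι) (D : PMF (Cube n)) (s : ℕ)
    (F : ι → (Fin s → Cube n) → ℝ) :
    expSamples D s (fun y => ∑ i ∈ t, F i y) = ∑ i ∈ t, expSamples D s (F i) := by
  simp only [expSamples, Finset.mul_sum]
  exact Finset.sum_comm

end OracleAlg

/-! ### Product measures on the cube -/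

/-- The weight of a bit that is `false` with probability `p`. -/
def bitWeight (p : ℝ) (b : Bool) : ℝ := if b then 1 - p else p

lemma bitWeight_nonneg {p : ℝ} (h0 : 0 ≤ p) (h1 : p ≤ 1) (b : Bool) : 0 ≤ bitWeight p b := by
  cases b <;> simp [bitWeight, h0, h1]

/-- The expectation of `F z` when the bits of `z` are independent and bit `v` is `false` with
probability `p v`. -/
def prodExp {n : ℕ} (p : Fin n → ℝ) (F : Cube n → ℝ) : ℝ :=
  ∑ z : Cube n, (∏ v, bitWeight (p v) (z v)) * F z

variable {n : ℕ}

lemma sum_cube_prod (g : Fin n → Bool → ℝ) :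
    ∑ z : Cube n, ∏ v, g v (z v) = ∏ v, (g v true + g v false) := by
  rw [← Fintype.prod_sum]
  simp

lemma prodExp_const (p : Fin n → ℝ) (c : ℝ) : prodExp p (fun _ => c) = c := by
  rw [prodExp, ← Finset.sum_mul, sum_cube_prod (fun v => bitWeight (p v))]
  simp [bitWeight]

lemma prodExp_mono {p : Fin n → ℝ} (h0 : ∀ v, 0 ≤ p v) (h1 : ∀ v, p v ≤ 1)
    {F G : Cube n → ℝ} (h : ∀ z, F z ≤ G z) : prodExp p F ≤ prodExp p G :=
  Finset.sum_le_sum fun z _ => mul_le_mul_of_nonneg_left (h z)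
    (Finset.prod_nonneg fun v _ => bitWeight_nonneg (h0 v) (h1 v) _)

lemma prodExp_sub (p : Fin n → ℝ) (F G : Cube n → ℝ) :
    prodExp p (fun z => F z - G z) = prodExp p F - prodExp p G := by
  simp only [prodExp, mul_sub, Finset.sum_sub_distrib]

lemma prodExp_sum {ι : Type*} (t : Finset ι) (p : Fin n → ℝ) (F : ι → Cube n → ℝ) :
    prodExp p (fun z => ∑ i ∈ t, F i z) = ∑ i ∈ t, prodExp p (F i) := by
  simp only [prodExp, Finset.mul_sum]
  exact Finset.sum_comm

/-- The indicator of the event that bit `i` is `false`. -/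
def isZero (i : Fin n) (z : Cube n) : ℝ := if z i = false then 1 else 0

/-- Conditioning a product measure on bit `i` being `false`. -/
lemma prodExp_isZero_mul (p : Fin n → ℝ) (i : Fin n) (F : Cube n → ℝ) :
    prodExp p (fun z => isZero i z * F z) =
      p i * prodExp p fun z => F (Function.update z i false) := by
  cases n with
  | zero => exact i.elim0
  | succ n =>
    simp only [prodExp]
    rw [← (Fin.insertNthEquiv (fun _ => Bool) i).sum_comp,
      ← (Fin.insertNthEquiv (fun _ => Bool) i).sum_comp, Fintype.sum_prod_type,
      Fintype.sum_prod_type]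
    simp only [Fin.insertNthEquiv, Equiv.coe_fn_mk, Fin.prod_univ_succAbove _ i,
      Fin.insertNth_apply_same, Fin.insertNth_apply_succAbove, Fin.update_insertNth, isZero,
      Fintype.sum_bool, bitWeight, Finset.mul_sum, ← Finset.sum_add_distrib]
    refine Finset.sum_congr rfl fun z _ => ?_
    simp
    ring

/-- A product measure with rational parameters is the image of a uniform distribution. -/
lemma average_threshold (m : ℕ) (hm : 0 < m) (N : Fin n → ℕ) (hN : ∀ v, N v ≤ m)
    (F : Cube n → ℝ) :
    (∑ w : Fin n → Fin m, F fun v => !decide ((w v : ℕ) < N v)) /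
        Fintype.card (Fin n → Fin m) = prodExp (fun v => (N v : ℝ) / m) F := by
  have hm' : (m : ℝ) ≠ 0 := by positivity
  have hcard : ∀ (v : Fin n) (b : Bool),
      ((Finset.univ.filter fun a : Fin m => (!decide ((a : ℕ) < N v)) = b).card : ℝ) =
        m * bitWeight ((N v : ℝ) / m) b := by
    intro v b
    have h1 : (Finset.univ.filter fun a : Fin m => (a : ℕ) < N v).card = N v := by
      rw [Fin.card_filter_val_lt, min_eq_right (hN v)]
    cases b
    · simp only [bitWeight]
      simp only [Bool.not_eq_false', decide_eq_true_eq, h1]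
      simp; field_simp
    · have h2 := Finset.card_filter_add_card_filter_not (s := (Finset.univ : Finset (Fin m)))
        (fun a : Fin m => (a : ℕ) < N v)
      rw [h1, Finset.card_univ, Fintype.card_fin] at h2
      simp only [bitWeight, Bool.not_eq_true', decide_eq_false_iff_not]
      have h3 : (N v : ℝ) + ((Finset.univ.filter fun a : Fin m => ¬ (a : ℕ) < N v).card : ℝ) = m := by
        exact_mod_cast h2
      simp only [if_true]
      rw [mul_sub, mul_one, mul_div_cancel₀ _ hm']
      linarith
  rw [prodExp, Finset.sum_div,
    ← Finset.sum_fiberwise (s := Finset.univ)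
      (g := fun (w : Fin n → Fin m) (v : Fin n) => !decide ((w v : ℕ) < N v))]
  refine Finset.sum_congr rfl fun z _ => ?_
  -- The thresholds producing a given `z` form a box, so their number is a product over the bits.
  have h1 : (Finset.univ.filter fun w : Fin n → Fin m =>
      (fun v => !decide ((w v : ℕ) < N v)) = z) =
      Fintype.piFinset fun v =>
        Finset.univ.filter fun a : Fin m => (!decide ((a : ℕ) < N v)) = z v := by
    ext w
    simp [funext_iff]
  rw [← Finset.sum_div, Finset.sum_congr rfl (g := fun _ => F z)
    (fun w hw => by rw [(Finset.mem_filter.1 hw).2]), Finset.sum_const, h1,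
    Fintype.card_piFinset, nsmul_eq_mul, Nat.cast_prod, Finset.prod_congr rfl
    (fun v _ => hcard v (z v)), Finset.prod_mul_distrib]
  simp
  field_simp

lemma one_sub_sum_le_prod {ι : Type*} (s : Finset ι) (e : ι → ℝ) (h0 : ∀ i ∈ s, 0 ≤ e i)
    (h1 : ∀ i ∈ s, e i ≤ 1) : 1 - ∑ i ∈ s, e i ≤ ∏ i ∈ s, (1 - e i) := by
  classical
  have key : 1 - ∑ i ∈ s, e i ≤ ∏ i ∈ s, (1 - e i) ∧ ∏ i ∈ s, (1 - e i) ≤ 1 := by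
    induction s using Finset.induction_on with
    | empty => simp
    | insert a s ha ih =>
      obtain ⟨ih1, ih2⟩ := ih (fun i hi => h0 i (Finset.mem_insert_of_mem hi))
        (fun i hi => h1 i (Finset.mem_insert_of_mem hi))
      rw [Finset.sum_insert ha, Finset.prod_insert ha]
      have a0 := h0 a (Finset.mem_insert_self _ _)
      have a1 := h1 a (Finset.mem_insert_self _ _)
      have p0 : 0 ≤ ∏ i ∈ s, (1 - e i) := Finset.prod_nonneg fun i hi =>
        sub_nonneg.2 (h1 i (Finset.mem_insert_of_mem hi))
      constructor <;> nlinarith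
  exact key.1

/-- Comparison of two product measures on the cube: apart from the bits which are constant under
the second measure, the loss is governed by the `χ²`-divergence. -/
lemma prodExp_le_of_chiSq (a b : Fin n → ℝ) (ha0 : ∀ v, 0 ≤ a v) (ha1 : ∀ v, a v ≤ 1)
    (hb0 : ∀ v, 0 ≤ b v) (hb1 : ∀ v, b v < 1) (e : Fin n → ℝ)
    (he0 : ∀ v, b v = 0 → 0 ≤ e v)
    (he : ∀ v, b v ≠ 0 → (a v - b v) ^ 2 / (b v * (1 - b v)) ≤ e v)
    (F : Cube n → ℝ) (hF0 : ∀ z, 0 ≤ F z) (hF1 : ∀ z, F z ≤ 1) :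
    prodExp a F ≤ (∑ v, if b v = 0 then a v else 0) +
      √(prodExp b F * Real.exp (∑ v, e v)) := by
  classical
  -- `a'` drops from `a` the mass of zeros that are impossible under `b`. This makes the density
  -- finite and costs at most the sum of the dropped probabilities.
  set a' : Fin n → Bool → ℝ := fun v x => if x then 1 - a v else if b v = 0 then 0 else a v
    with ha'
  have ha'0 : ∀ v x, 0 ≤ a' v x := by
    intro v x
    simp only [ha']
    have := ha0 v; have := ha1 v
    split_ifs <;> linarith
  have ha'le : ∀ v x, a' v x ≤ bitWeight (a v) x := by
    intro v x
    simp only [ha', bitWeight]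
    have := ha0 v
    split_ifs <;> linarith
  have hb'0 : ∀ v x, 0 ≤ bitWeight (b v) x := fun v x => bitWeight_nonneg (hb0 v) (hb1 v).le x
  set Q : Cube n → ℝ := fun z => ∏ v, a' v (z v) with hQ
  have hsplit : prodExp a F - ∑ z, Q z * F z ≤ ∑ v, if b v = 0 then a v else 0 := by
    have h1 : prodExp a F - ∑ z, Q z * F z ≤
        ∑ z : Cube n, ((∏ v, bitWeight (a v) (z v)) - Q z) := by
      rw [prodExp, ← Finset.sum_sub_distrib]
      refine Finset.sum_le_sum fun z _ => ?_
      rw [← sub_mul]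
      refine mul_le_of_le_one_right (sub_nonneg.2 ?_) (hF1 z)
      exact Finset.prod_le_prod (fun v _ => ha'0 v _) fun v _ => ha'le v _
    have h2 : ∑ z : Cube n, ∏ v, bitWeight (a v) (z v) = 1 := by
      rw [sum_cube_prod fun v => bitWeight (a v)]
      simp [bitWeight]
    have h3 : ∑ z, Q z = ∏ v, (1 - if b v = 0 then a v else 0) := by
      rw [hQ, sum_cube_prod a']
      refine Finset.prod_congr rfl fun v _ => ?_
      simp only [ha']
      by_cases hb : b v = 0 <;> simp [hb]
    have h4 := one_sub_sum_le_prod Finset.univ (fun v => if b v = 0 then a v else 0)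
      (fun v _ => by have := ha0 v; split_ifs <;> linarith)
      (fun v _ => by have := ha1 v; split_ifs <;> linarith)
    rw [Finset.sum_sub_distrib, h2, h3] at h1
    linarith
  -- Cauchy–Schwarz with weights `b`, using `F² ≤ F`; the second factor is a product of terms at
  -- most `1 + e v ≤ exp (e v)`.
  have hcs : (∑ z, Q z * F z) ^ 2 ≤ prodExp b F * Real.exp (∑ v, e v) := by
    have h1 : (∑ z, Q z * F z) ^ 2 ≤
        (∑ z : Cube n, (∏ v, bitWeight (b v) (z v)) * F z) *
          ∑ z : Cube n, ∏ v, a' v (z v) ^ 2 / bitWeight (b v) (z v) := by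
      refine Finset.sum_sq_le_sum_mul_sum_of_sq_le_mul _
        (fun z _ => mul_nonneg (Finset.prod_nonneg fun v _ => hb'0 v _) (hF0 z))
        (fun z _ => Finset.prod_nonneg fun v _ => div_nonneg (sq_nonneg _) (hb'0 v _))
        fun z _ => ?_
      have h2 : Q z ^ 2 = (∏ v, bitWeight (b v) (z v)) *
          ∏ v, a' v (z v) ^ 2 / bitWeight (b v) (z v) := by
        rw [hQ, ← Finset.prod_mul_distrib, ← Finset.prod_pow]
        refine Finset.prod_congr rfl fun v _ => ?_
        -- Here division by zero gives `0`, which is right because `a'` vanishes there too.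
        by_cases h : bitWeight (b v) (z v) = 0
        · have hz : z v = false := by
            by_contra hz
            have := hb1 v
            rw [Bool.not_eq_false] at hz
            simp only [bitWeight, hz, if_true] at h
            linarith
          have hb : b v = 0 := by simpa [bitWeight, hz] using h
          simp [ha', hz, hb]
        · field_simp
      rw [mul_pow, h2, mul_right_comm]
      refine mul_le_mul_of_nonneg_right (mul_le_mul_of_nonneg_left ?_
        (Finset.prod_nonneg fun v _ => hb'0 v _))
        (Finset.prod_nonneg fun v _ => div_nonneg (sq_nonneg _) (hb'0 v _))
      nlinarith [hF0 z, hF1 z]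
    refine h1.trans (mul_le_mul_of_nonneg_left ?_ (Finset.sum_nonneg fun z _ =>
      mul_nonneg (Finset.prod_nonneg fun v _ => hb'0 v _) (hF0 z)))
    rw [sum_cube_prod fun v x => a' v x ^ 2 / bitWeight (b v) x, Real.exp_sum]
    refine Finset.prod_le_prod (fun v _ => add_nonneg (div_nonneg (sq_nonneg _) (hb'0 v _))
      (div_nonneg (sq_nonneg _) (hb'0 v _))) fun v _ => ?_
    by_cases hb : b v = 0
    · have := Real.add_one_le_exp (e v)
      have := he0 v hb
      have := ha0 v
      have := ha1 v
      simp [ha', bitWeight, hb]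
      nlinarith
    · have h3 := Real.add_one_le_exp (e v)
      have h4 := he v hb
      have h5 : 1 - b v ≠ 0 := by have := hb1 v; intro h; linarith
      have h6 : (1 - a v) ^ 2 / (1 - b v) + a v ^ 2 / b v =
          1 + (a v - b v) ^ 2 / (b v * (1 - b v)) := by
        field_simp
        ring
      simp only [ha', bitWeight, hb, if_true, if_false, Bool.false_eq_true]
      linarith
  have := Real.le_sqrt_of_sq_le hcs
  linarith

/-- A second moment bound for hitting a set of bits. -/
lemma le_prodExp_of_hit (p : Fin n → ℝ) (h0 : ∀ v, 0 ≤ p v) (h1 : ∀ v, p v ≤ 1)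
    (I : Finset (Fin n)) (G : Cube n → ℝ) (hG0 : ∀ z, 0 ≤ G z) (hG1 : ∀ z, G z ≤ 1)
    (c : ℝ) (hc : ∀ i ∈ I, c ≤ prodExp p fun z => G (Function.update z i false)) :
    c * ∑ i ∈ I, p i - (∑ i ∈ I, p i) ^ 2 ≤ prodExp p G := by
  classical
  -- With `k` zeros of `z` in `I`, this is `k G - k (k - 1)`, a Bonferroni-type lower bound for `G`:
  -- for `k ≥ 1` it equals `G + (k - 1) (G - k)`.
  set X : Cube n → ℝ := fun z =>
    ∑ i ∈ I, isZero i z * G z - ∑ i ∈ I, ∑ j ∈ I.erase i, isZero i z * isZero j z with hX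
  have hle : ∀ z, X z ≤ G z := by
    intro z
    have e1 : ∑ i ∈ I, isZero i z = ((I.filter fun i => z i = false).card : ℝ) := by
      simp [isZero]
    have e2 : ∑ i ∈ I, ∑ j ∈ I.erase i, isZero i z * isZero j z =
        (∑ i ∈ I, isZero i z) * (∑ i ∈ I, isZero i z) - ∑ i ∈ I, isZero i z := by
      rw [Finset.sum_mul_sum, ← Finset.sum_sub_distrib]
      refine Finset.sum_congr rfl fun i hi => ?_
      rw [← Finset.add_sum_erase _ _ hi]
      have : isZero i z * isZero i z = isZero i z := by simp [isZero]
      rw [this]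
      ring
    simp only [hX, e2, ← Finset.sum_mul, e1]
    generalize (I.filter fun i => z i = false).card = k
    have := hG0 z
    have := hG1 z
    rcases k with _ | k
    · simpa
    · push_cast
      have : (0 : ℝ) ≤ k := Nat.cast_nonneg k
      nlinarith
  refine le_trans ?_ (prodExp_mono h0 h1 hle)
  have h2 : prodExp p X = ∑ i ∈ I, p i * prodExp p (fun z => G (Function.update z i false)) -
      ∑ i ∈ I, ∑ j ∈ I.erase i, p i * p j := by
    rw [hX, prodExp_sub, prodExp_sum, prodExp_sum]
    congr 1
    · exact Finset.sum_congr rfl fun i _ => prodExp_isZero_mul p i G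
    · refine Finset.sum_congr rfl fun i _ => ?_
      rw [prodExp_sum]
      refine Finset.sum_congr rfl fun j hj => ?_
      rw [prodExp_isZero_mul]
      have h3 := prodExp_isZero_mul p j fun _ => 1
      simp only [mul_one, prodExp_const] at h3
      rw [← h3]
      congr 2
      funext z
      simp [isZero, Function.update_of_ne (Finset.ne_of_mem_erase hj)]
  rw [h2]
  have h4 : ∑ i ∈ I, c * p i ≤
      ∑ i ∈ I, p i * prodExp p fun z => G (Function.update z i false) :=
    Finset.sum_le_sum fun i hi => by
      rw [mul_comm]
      exact mul_le_mul_of_nonneg_left (hc i hi) (h0 i)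
  have h5 : ∑ i ∈ I, ∑ j ∈ I.erase i, p i * p j ≤ (∑ i ∈ I, p i) ^ 2 := by
    rw [sq, Finset.sum_mul_sum]
    refine Finset.sum_le_sum fun i _ => Finset.sum_le_sum_of_subset_of_nonneg
      (Finset.erase_subset _ _) fun j _ _ => mul_nonneg (h0 i) (h0 j)
  rw [← Finset.mul_sum] at h4
  linarith

/-! ### The two tests and their query counts -/

namespace OracleAlg

variable {n : ℕ}

/-- The string which agrees with `x` before position `j` and is `1` from `j` on. -/
def cubePrefix (x : Cube n) (j : ℕ) : Cube n := fun v => if (v : ℕ) < j then x v else true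

/-- The string whose only zero is at position `i`. -/
def singleZero (i : Fin n) : Cube n := Function.update (fun _ => true) i false

/-- Binary search, among the `2 ^ t` positions from `a` on, for a position at which the value of
`f` on the prefixes of `x` changes. -/
def search (x : Cube n) (next : ℕ → OracleAlg n) : ℕ → ℕ → OracleAlg n
  | 0, a => next a
  | t + 1, a => query (cubePrefix x (a + 2 ^ t)) fun b =>
      if b then search x next t (a + 2 ^ t) else search x next t a

/-- The result of the binary search. -/
def searchResult (f : BoolFun n) (x : Cube n) : ℕ → ℕ → ℕ
  | 0, a => a
  | t + 1, a => if f (cubePrefix x (a + 2 ^ t)) then searchResult f x t (a + 2 ^ t)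
      else searchResult f x t a

lemma acc_search (f : BoolFun n) (D : PMF (Cube n)) (x : Cube n) (next : ℕ → OracleAlg n)
    (t a : ℕ) : acc f D (search x next t a) = acc f D (next (searchResult f x t a)) := by
  induction t generalizing a with
  | zero => rfl
  | succ t ih =>
    rw [search, acc_query, searchResult]
    split_ifs <;> exact ih _

lemma queries_search_le {x : Cube n} {next : ℕ → OracleAlg n} {c : ℕ}
    (h : ∀ j, (next j).queries ≤ c) (t a : ℕ) : (search x next t a).queries ≤ t + c := by
  induction t generalizing a with
  | zero => simpa [search] using h a
  | succ t ih =>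
    rw [search, add_comm t 1, add_assoc]
    refine queries_query_le fun b => ?_
    split_ifs <;> exact ih _

/-- The search keeps value `1` at the left end of its interval and `0` at the right end; no
monotonicity is needed. -/
lemma searchResult_spec (f : BoolFun n) (x : Cube n) (t a : ℕ)
    (h1 : f (cubePrefix x a) = true) (h2 : f (cubePrefix x (a + 2 ^ t)) = false) :
    f (cubePrefix x (searchResult f x t a)) = true ∧
      f (cubePrefix x (searchResult f x t a + 1)) = false := by
  induction t generalizing a with
  | zero => exact ⟨h1, h2⟩
  | succ t ih =>
    rw [searchResult]
    split_ifs with h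
    · exact ih _ h (by rw [← h2, pow_succ]; congr 2; ring)
    · exact ih _ h1 (by simpa using h)

/-- The position found by binary search from the `0`-string `x`, provided that it certifies
`f x = 0`. -/
def Certifies (f : BoolFun n) (x : Cube n) (i : Fin n) : Prop :=
  x i = false ∧ f (singleZero i) = false

lemma exists_certifies_of_mem {f : BoolFun n} (hf : f ∈ Mconj n) {x : Cube n}
    (hx : f x = false) {t : ℕ} (ht : n ≤ 2 ^ t) :
    ∃ h : searchResult f x t 0 < n, Certifies f x ⟨searchResult f x t 0, h⟩ := by
  obtain ⟨S, hS⟩ := hf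
  have hfalse : ∀ z, f z = false ↔ ∃ i ∈ S, z i = false := by
    intro z
    rw [← Bool.not_eq_true, hS]
    push Not
    simp
  have h1 : f (cubePrefix x 0) = true := by
    rw [hS]
    simp [cubePrefix]
  -- Positions past `n` are harmless: the prefix is already all of `x`.
  have h2 : cubePrefix x (0 + 2 ^ t) = x := by
    funext v
    simp only [cubePrefix]
    rw [if_pos]
    have := v.2
    omega
  obtain ⟨h3, h4⟩ := searchResult_spec f x t 0 h1 (by rw [h2, hx])
  rw [hfalse] at h4
  obtain ⟨i, hiS, hi⟩ := h4
  have h5 := (hS _).1 h3 i hiS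
  simp only [cubePrefix] at hi h5
  have h6 : (i : ℕ) = searchResult f x t 0 := by
    by_contra hne
    by_cases hlt : (i : ℕ) < searchResult f x t 0
    · rw [if_pos hlt] at h5
      rw [if_pos (by omega), h5] at hi
      exact Bool.noConfusion hi
    · rw [if_neg (by omega)] at hi
      exact Bool.noConfusion hi
  rw [if_pos (by omega)] at hi
  refine ⟨h6 ▸ i.2, ?_⟩
  have h7 : (⟨searchResult f x t 0, h6 ▸ i.2⟩ : Fin n) = i := Fin.ext h6.symm
  rw [h7]
  refine ⟨hi, (hfalse _).2 ⟨i, hiS, by simp [singleZero]⟩⟩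

/-- The number of sampled `1`-strings with a zero at `v`. -/
def zeroCount {s : ℕ} (y : Fin s → Cube n × Bool) (v : Fin n) : ℕ :=
  (Finset.univ.filter fun k => (y k).2 = true ∧ (y k).1 v = false).card

lemma zeroCount_le {s : ℕ} (y : Fin s → Cube n × Bool) (v : Fin n) : zeroCount y v ≤ s :=
  (Finset.card_filter_le _ _).trans (by simp)

/-- A string with a zero at `v` for a fraction of the thresholds proportional to the number of
sampled `1`-strings with a zero at `v`. -/
def pick {s m : ℕ} (y : Fin s → Cube n × Bool) (w : Fin n → Fin m) : Cube n :=
  fun v => !decide ((w v : ℕ) < zeroCount y v)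

/-- Combine `r` samples into a random string, and check it together with a certifying position of
one more sample. -/
def certTest (r m t : ℕ) [NeZero m] : OracleAlg n :=
  samples r fun y => uniform (Fin n → Fin m) fun w => sample fun x b =>
    if b then halt true else
      search x (fun j =>
        if h : j < n then
          if x ⟨j, h⟩ = false then
            query (singleZero ⟨j, h⟩) fun c =>
              if c then halt false else
                query (Function.update (pick y w) ⟨j, h⟩ false) fun c' => halt (!c')
          else halt false
        else halt false) t 0

/-- Check that `M` random combinations of `s` samples are `1`-strings. -/
def unionTest (s m M : ℕ) [NeZero m] : OracleAlg n :=
  samples s fun y =>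
    iter (uniform (Fin n → Fin m) fun w => query (pick y w) halt) M

/-- The one-sided tester. -/
def tester (r m t M R : ℕ) [NeZero m] : OracleAlg n :=
  seq (iter (certTest r m t) R) (iter (unionTest (r + 1) m M) R)

lemma queries_certTest_le (r m t : ℕ) [NeZero m] :
    (certTest r m t : OracleAlg n).queries ≤ r + (1 + (t + 2)) := by
  refine queries_samples_le fun y => queries_uniform_le fun w => queries_sample_le fun x b => ?_
  split_ifs
  · simp [queries]
  · refine queries_search_le (fun j => ?_) t 0
    split_ifs with h h'
    · refine queries_query_le (c := 1) fun c => ?_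
      split_ifs
      · simp [queries]
      · exact queries_query_le (c := 0) fun c => by simp [queries]
    · simp [queries]
    · simp [queries]

lemma queries_unionTest_le (s m M : ℕ) [NeZero m] :
    (unionTest s m M : OracleAlg n).queries ≤ s + M := by
  refine queries_samples_le fun y => (queries_iter _ _).trans ?_
  refine (Nat.mul_le_mul_left M (queries_uniform_le (c := 1) fun w => ?_)).trans (by simp)
  exact queries_query_le (c := 0) fun c => by simp [queries]

lemma queries_tester_le (r m t M R : ℕ) [NeZero m] :
    (tester r m t M R : OracleAlg n).queries ≤
      R * (r + (1 + (t + 2))) + R * (r + 1 + M) := by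
  refine (queries_seq _ _).trans (add_le_add ?_ ?_)
  · exact (queries_iter _ _).trans (Nat.mul_le_mul_left R (queries_certTest_le r m t))
  · exact (queries_iter _ _).trans (Nat.mul_le_mul_left R (queries_unionTest_le (r + 1) m M))

/-! ### Acceptance probabilities of the tests -/

/-- The labelled sample sequence belonging to a sequence of strings. -/
def labelled {s : ℕ} (f : BoolFun n) (y : Fin s → Cube n) : Fin s → Cube n × Bool :=
  fun k => (y k, f (y k))

/-- The probability that bit `v` of the random combination is zero. -/
def pickProb {s : ℕ} (m : ℕ) (f : BoolFun n) (y : Fin s → Cube n) (v : Fin n) : ℝ :=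
  (zeroCount (labelled f y) v : ℝ) / m

/-- Real-valued indicator of `f z = b`. -/
def valInd (f : BoolFun n) (b : Bool) (z : Cube n) : ℝ := if f z = b then 1 else 0

open Classical in
/-- The probability of acceptance of the certificate test after the samples `y` and the last
sample `x`. -/
def certAcc {r : ℕ} (m t : ℕ) (f : BoolFun n) (y : Fin r → Cube n) (x : Cube n) : ℝ :=
  if f x = true then 1 else
    if h : ∃ h : searchResult f x t 0 < n, Certifies f x ⟨searchResult f x t 0, h⟩ then
      prodExp (pickProb m f y) fun z =>
        valInd f false (Function.update z ⟨searchResult f x t 0, h.1⟩ false)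
    else 0

lemma acc_pick {s : ℕ} (m : ℕ) [NeZero m] (hm : s ≤ m) (f : BoolFun n)
    (D : PMF (Cube n)) (y : Fin s → Cube n) (next : Cube n → OracleAlg n) :
    acc f D (uniform (Fin n → Fin m) fun w => next (pick (labelled f y) w)) =
      prodExp (pickProb m f y) fun z => acc f D (next z) := by
  rw [acc_uniform]
  exact average_threshold m (NeZero.pos m) _ (fun v => (zeroCount_le _ v).trans hm)
    fun z => acc f D (next z)

lemma acc_certTest (r m t : ℕ) [NeZero m] (hm : r ≤ m) (f : BoolFun n) (D : PMF (Cube n)) :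
    acc f D (certTest r m t) =
      expSamples D r fun y => ∑ x, (D x).toReal * certAcc m t f y x := by
  classical
  rw [certTest, acc_samples]
  congr 1
  funext y
  have h := acc_pick m hm f D y fun z => sample fun x b =>
    if b then halt true else
      search x (fun j =>
        if h : j < n then
          if x ⟨j, h⟩ = false then
            query (singleZero ⟨j, h⟩) fun c =>
              if c then halt false else
                query (Function.update z ⟨j, h⟩ false) fun c' => halt (!c')
          else halt false
        else halt false) t 0
  refine h.trans ?_
  simp only [acc_sample]
  rw [prodExp_sum]
  refine Finset.sum_congr rfl fun x _ => ?_
  have hmul : ∀ (c : ℝ) (F : Cube n → ℝ) (p : Fin n → ℝ),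
      prodExp p (fun z => c * F z) = c * prodExp p F := fun c F p => by
    simp only [prodExp, Finset.mul_sum]
    exact Finset.sum_congr rfl fun z _ => by ring
  rw [hmul]
  congr 1
  rw [certAcc]
  split_ifs with h1 h2
  · simp [prodExp_const]
  · obtain ⟨h3, h4, h5⟩ := h2
    simp only [acc_search, h3, h4, h5, dif_pos, if_true, acc_query, Bool.false_eq_true,
      if_false, acc_halt, valInd, Bool.not_eq_true']
  · simp only [acc_search, Certifies, not_exists, not_and] at h2 ⊢
    rw [← prodExp_const (pickProb m f y) 0]
    congr 1
    funext z
    split_ifs with h3 h4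
    · simp [h2 h3 h4]
    · simp
    · simp

lemma acc_unionTest (s m M : ℕ) [NeZero m] (hm : s ≤ m) (f : BoolFun n) (D : PMF (Cube n)) :
    acc f D (unionTest s m M) =
      expSamples D s fun y => (1 - prodExp (pickProb m f y) (valInd f false)) ^ M := by
  rw [unionTest, acc_samples]
  congr 1
  funext y
  rw [acc_iter]
  congr 1
  have h := acc_pick m hm f D y fun z => query z halt
  refine h.trans ?_
  have h2 := prodExp_sub (pickProb m f y) (fun _ => 1) (valInd f false)
  rw [prodExp_const] at h2
  rw [← h2]
  congr 1
  funext z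
  rw [acc_query, acc_halt, valInd]
  cases f z <;> simp

/-! ### One-sided error -/

lemma acc_certTest_of_mem {f : BoolFun n} (hf : f ∈ Mconj n) (D : PMF (Cube n))
    (r m t : ℕ) [NeZero m] (hm : r ≤ m) (ht : n ≤ 2 ^ t) :
    acc f D (certTest r m t) = 1 := by
  have hone : ∀ y x, certAcc (r := r) m t f y x = 1 := by
    intro y x
    rw [certAcc]
    split_ifs with h1 h2
    · rfl
    · rw [← prodExp_const (pickProb m f y) 1]
      congr 1
      funext z
      obtain ⟨S, hS⟩ := hf
      obtain ⟨h3, -, h4⟩ := h2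
      rw [valInd, if_pos]
      rw [← Bool.not_eq_true, hS] at h4 ⊢
      intro h5
      -- If the updated string had value `1`, the certified position would lie outside `S`, and
      -- `singleZero` there would have value `1`.
      refine h4 fun i hi => ?_
      have := h5 i hi
      rw [singleZero]
      by_cases h6 : i = ⟨searchResult f x t 0, h3⟩
      · rw [h6, Function.update_self] at this
        exact absurd this (by decide)
      · rw [Function.update_of_ne h6]
    · exact absurd (exists_certifies_of_mem hf (by simpa using h1) ht) h2
  rw [acc_certTest r m t hm]
  simp only [hone, mul_one, sum_toReal, expSamples_const]

lemma acc_unionTest_of_mem {f : BoolFun n} (hf : f ∈ Mconj n) (D : PMF (Cube n))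
    (s m M : ℕ) [NeZero m] : acc f D (unionTest s m M) = 1 := by
  obtain ⟨S, hS⟩ := hf
  have hpick : ∀ (y : Fin s → Cube n) (w : Fin n → Fin m),
      f (pick (fun k => (y k, f (y k))) w) = true := by
    intro y w
    rw [hS]
    intro i hi
    by_contra h
    simp only [pick, Bool.not_eq_true', decide_eq_false_iff_not, not_not, zeroCount] at h
    obtain ⟨k, hk⟩ := Finset.card_pos.1 ((Nat.zero_le _).trans_lt h)
    obtain ⟨h1, h2⟩ := (Finset.mem_filter.1 hk).2
    have := (hS _).1 h1 i hi
    rw [h2] at this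
    exact Bool.noConfusion this
  rw [unionTest, acc_samples]
  simp only [acc_iter, acc_uniform, acc_query, hpick, acc_halt, if_true, Finset.sum_const,
    Finset.card_univ, nsmul_eq_mul, mul_one]
  rw [div_self (by positivity)]
  simp only [one_pow, expSamples_const]

lemma acc_tester_of_mem {f : BoolFun n} (hf : f ∈ Mconj n) (D : PMF (Cube n))
    (r m t M R : ℕ) [NeZero m] (hm : r ≤ m) (ht : n ≤ 2 ^ t) :
    acc f D (tester r m t M R) = 1 := by
  rw [tester, acc_seq, acc_iter, acc_iter, acc_certTest_of_mem hf D r m t hm ht,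
    acc_unionTest_of_mem hf]
  simp


/-! ### Soundness: rarity and the effect of one sample -/

/-- `z` is a `1`-string with a zero at `v`. -/
def Covers (f : BoolFun n) (z : Cube n) (v : Fin n) : Prop := f z = true ∧ z v = false

instance (f : BoolFun n) (z : Cube n) (v : Fin n) : Decidable (Covers f z v) :=
  inferInstanceAs (Decidable (_ ∧ _))

lemma zeroCount_labelled {s : ℕ} (f : BoolFun n) (y : Fin s → Cube n) (v : Fin n) :
    zeroCount (labelled f y) v = ∑ k, if Covers f (y k) v then 1 else 0 := by
  rw [zeroCount, Finset.card_filter]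
  rfl

lemma zeroCount_labelled_succAbove {r : ℕ} (f : BoolFun n) (y : Fin (r + 1) → Cube n)
    (k : Fin (r + 1)) (v : Fin n) :
    zeroCount (labelled f y) v = (if Covers f (y k) v then 1 else 0) +
      zeroCount (labelled f fun j => y (k.succAbove j)) v := by
  rw [zeroCount_labelled, zeroCount_labelled, Fin.sum_univ_succAbove _ k]

/-- A measure of how much of the zeros of the `k`-th sample are not shared by other samples. -/
def rarity {s : ℕ} (f : BoolFun n) (y : Fin s → Cube n) (k : Fin s) : ℝ :=
  ∑ v, if Covers f (y k) v then (zeroCount (labelled f y) v : ℝ)⁻¹ else 0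

/-- Each position `v` shares total weight at most `1` equally among the samples covering it. -/
lemma sum_rarity_le {s : ℕ} (f : BoolFun n) (y : Fin s → Cube n) :
    ∑ k, rarity f y k ≤ n := by
  simp only [rarity]
  rw [Finset.sum_comm]
  refine (Finset.sum_le_sum (g := fun _ => (1 : ℝ)) fun v _ => ?_).trans (by simp)
  rw [← Finset.sum_filter, Finset.sum_const, nsmul_eq_mul]
  have h : (Finset.univ.filter fun k => Covers f (y k) v).card = zeroCount (labelled f y) v := rfl
  rw [h]
  exact mul_inv_le_one

lemma pickProb_nonneg {s : ℕ} (m : ℕ) (f : BoolFun n) (y : Fin s → Cube n) (v : Fin n) :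
    0 ≤ pickProb m f y v := by
  unfold pickProb
  positivity

lemma pickProb_le {s m : ℕ} {c : ℝ} (hm : 0 < m) (hs : (s : ℝ) ≤ c * m) (f : BoolFun n)
    (y : Fin s → Cube n) (v : Fin n) : pickProb m f y v ≤ c := by
  rw [pickProb, div_le_iff₀ (by exact_mod_cast hm)]
  exact le_trans (by exact_mod_cast zeroCount_le _ v) hs

lemma prodExp_valInd_false (f : BoolFun n) (p : Fin n → ℝ) (g : Cube n → Cube n) :
    prodExp p (fun z => valInd f false (g z)) = 1 - prodExp p fun z => valInd f true (g z) := by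
  rw [← prodExp_const p 1, ← prodExp_sub]
  congr 1
  funext z
  rw [valInd, valInd]
  cases f (g z) <;> simp

lemma valInd_nonneg (f : BoolFun n) (b : Bool) (z : Cube n) : 0 ≤ valInd f b z := by
  unfold valInd
  split_ifs <;> norm_num

lemma valInd_le_one (f : BoolFun n) (b : Bool) (z : Cube n) : valInd f b z ≤ 1 := by
  unfold valInd
  split_ifs <;> norm_num

/-- The probability that the random combination of `y` with an added zero at `i` is
a `1`-string. -/
def escapeProb {s : ℕ} (m : ℕ) (f : BoolFun n) (y : Fin s → Cube n) (i : Fin n) : ℝ :=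
  prodExp (pickProb m f y) fun z => valInd f true (Function.update z i false)

/-- Adding a sample of small rarity changes `escapeProb` little. -/
lemma escapeProb_le_half {r m : ℕ} (hm : 0 < m) (hr : ((r + 1 : ℕ) : ℝ) ≤ 1 / 2 * m)
    (f : BoolFun n) (y : Fin (r + 1) → Cube n) (k : Fin (r + 1))
    (hk : 100 * rarity f y k ≤ m) (i : Fin n)
    (hi : escapeProb m f (fun j => y (k.succAbove j)) i ≤ 1 / 16) :
    escapeProb m f y i ≤ 1 / 2 := by
  have hm' : (0 : ℝ) < m := by exact_mod_cast hm
  set γ : Fin r → Cube n := fun j => y (k.succAbove j) with hγ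
  have hr' : (r : ℝ) ≤ 1 / 2 * m := by push_cast at hr; linarith
  have hN : ∀ v, (zeroCount (labelled f y) v : ℝ) = (if Covers f (y k) v then 1 else 0) +
      zeroCount (labelled f γ) v := by
    intro v
    rw [zeroCount_labelled_succAbove f y k v]
    push_cast
    rfl
  -- With `G ≥ 1` other covering samples and `G / m ≤ 1/2`, the `χ²` term `1 / (m G (1 - G/m))` is
  -- at most `4 / (m (1 + G))`.
  set e : Fin n → ℝ := fun v =>
    4 / m * if Covers f (y k) v then (zeroCount (labelled f y) v : ℝ)⁻¹ else 0 with he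
  have hesum : ∑ v, e v ≤ 1 := by
    rw [he, ← Finset.mul_sum]
    change 4 / (m : ℝ) * rarity f y k ≤ 1
    rw [div_mul_eq_mul_div, div_le_one hm']
    linarith
  have hb : ∀ v, pickProb m f γ v ≤ 1 / 2 := pickProb_le hm hr' f γ
  have key := prodExp_le_of_chiSq (pickProb m f y) (pickProb m f γ) (pickProb_nonneg m f y)
    (fun v => (pickProb_le hm hr f y v).trans (by norm_num)) (pickProb_nonneg m f γ)
    (fun v => (hb v).trans_lt (by norm_num)) e
    (fun v _ => by
      simp only [he]
      split_ifs <;> positivity)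
    (fun v hv => by
      have hdiff : pickProb m f y v - pickProb m f γ v =
          (if Covers f (y k) v then 1 else 0) / m := by
        rw [pickProb, pickProb, hN v]
        ring
      rw [hdiff]
      simp only [he]
      split_ifs with hc
      · have hbv := hb v
        have hN1 := hN v
        rw [if_pos hc] at hN1
        have hg : (1 : ℝ) ≤ zeroCount (labelled f γ) v := by
          have : zeroCount (labelled f γ) v ≠ 0 := by
            intro h0
            apply hv
            rw [pickProb, h0]
            simp
          exact_mod_cast Nat.one_le_iff_ne_zero.2 this
        rw [hN1]
        rw [pickProb] at hbv ⊢
        set G : ℝ := (zeroCount (labelled f γ) v : ℝ)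
        have h1 : 1 / 2 ≤ 1 - G / m := by linarith
        have h2 : (1 + G) / 2 * (1 / 2) ≤ G * (1 - G / m) :=
          mul_le_mul (by linarith) h1 (by norm_num) (by linarith)
        have h3 : (1 / (m : ℝ)) ^ 2 / (G / m * (1 - G / m)) = 1 / m / (G * (1 - G / m)) := by
          field_simp
        have h4 : 4 / (m : ℝ) * (1 + G)⁻¹ = 1 / m / ((1 + G) / 2 * (1 / 2)) := by
          have : 1 + G ≠ 0 := by linarith
          field_simp
          norm_num
        rw [h3, h4]
        exact div_le_div_of_nonneg_left (by positivity) (by nlinarith) h2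
      · simp)
    (fun z => valInd f true (Function.update z i false)) (fun z => valInd_nonneg _ _ _)
    (fun z => valInd_le_one _ _ _)
  -- Positions covered by the `k`-th sample alone have count `1`, so each contributes exactly `1/m`
  -- to both sides.
  have hlight : (∑ v, if pickProb m f γ v = 0 then pickProb m f y v else 0) ≤ 1 / 100 := by
    have h1 : (∑ v, if pickProb m f γ v = 0 then pickProb m f y v else 0) ≤
        ∑ v, (1 / m : ℝ) * if Covers f (y k) v then (zeroCount (labelled f y) v : ℝ)⁻¹ else 0 := by
      refine Finset.sum_le_sum fun v _ => ?_
      split_ifs with h0 hc hc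
      · have h2 : (zeroCount (labelled f γ) v : ℝ) = 0 := by
          simpa [pickProb, hm.ne'] using h0
        rw [pickProb, hN v, if_pos hc, h2]
        simp
      · have h2 : (zeroCount (labelled f γ) v : ℝ) = 0 := by
          simpa [pickProb, hm.ne'] using h0
        rw [pickProb, hN v, if_neg hc, h2]
        simp
      · positivity
      · simp
    refine h1.trans ?_
    rw [← Finset.mul_sum]
    change 1 / (m : ℝ) * rarity f y k ≤ 1 / 100
    rw [div_mul_eq_mul_div, div_le_iff₀ hm']
    linarith
  -- `√(e/16) < 9/20`, which together with the loss `1/100` stays below `1/2`.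
  have hsqrt : √(escapeProb m f γ i * Real.exp (∑ v, e v)) ≤ 9 / 20 := by
    rw [Real.sqrt_le_left (by norm_num)]
    have h1 : Real.exp (∑ v, e v) ≤ 2.7182818286 :=
      (Real.exp_le_exp.2 hesum).trans Real.exp_one_lt_d9.le
    calc escapeProb m f γ i * Real.exp (∑ v, e v) ≤ 1 / 16 * 2.7182818286 :=
          mul_le_mul hi h1 (Real.exp_pos _).le (by norm_num)
      _ ≤ (9 / 20) ^ 2 := by norm_num
  unfold escapeProb at hsqrt ⊢
  linarith

/-- `z` is a `1`-string with a zero at a position which is rarely an escape for `y`. -/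
def Meets {s : ℕ} (m : ℕ) (f : BoolFun n) (y : Fin s → Cube n) (z : Cube n) : Prop :=
  ∃ i, Covers f z i ∧ escapeProb m f y i ≤ 1 / 16

open Classical in
/-- Samples which meet the good positions of the other samples make it likely that the random
combination is a `0`-string. -/
lemma card_le_of_meets {r m : ℕ} (hm : 0 < m) (hr : 4 * ((r + 1 : ℕ) : ℝ) ^ 2 ≤ m)
    (f : BoolFun n) (y : Fin (r + 1) → Cube n) (K : Finset (Fin (r + 1)))
    (hK : ∀ k ∈ K, Meets m f (fun j => y (k.succAbove j)) (y k) ∧ 100 * rarity f y k ≤ m) :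
    (K.card : ℝ) / (4 * m) ≤ prodExp (pickProb m f y) (valInd f false) := by
  have hm' : (0 : ℝ) < m := by exact_mod_cast hm
  have hs1 : (1 : ℝ) ≤ ((r + 1 : ℕ) : ℝ) := by push_cast; linarith [(Nat.cast_nonneg r : (0:ℝ) ≤ r)]
  have hr2 : ((r + 1 : ℕ) : ℝ) ≤ 1 / 2 * m := by nlinarith
  rcases K.eq_empty_or_nonempty with rfl | ⟨k₀, hk₀⟩
  · rw [Finset.card_empty, Nat.cast_zero, zero_div, ← prodExp_const (pickProb m f y) 0]
    exact prodExp_mono (pickProb_nonneg m f y)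
      (fun v => (pickProb_le hm hr2 f y v).trans (by norm_num)) (valInd_nonneg f false)
  have : Nonempty (Fin n) := ⟨(hK k₀ hk₀).1.choose⟩
  have hch : ∀ k ∈ K, ∃ i : Fin n, Covers f (y k) i ∧ escapeProb m f y i ≤ 1 / 2 := by
    intro k hk
    obtain ⟨⟨i, h1, h2⟩, h3⟩ := hK k hk
    exact ⟨i, h1, escapeProb_le_half hm hr2 f y k h3 i h2⟩
  choose! g hg using hch
  set I := K.image g with hI
  -- Several samples may choose the same position `i`, but at most `N_i` of them, since each covers
  -- it.
  have hcard : (K.card : ℝ) ≤ ∑ i ∈ I, (zeroCount (labelled f y) i : ℝ) := by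
    have h1 : K ⊆ I.biUnion fun i => Finset.univ.filter fun k => Covers f (y k) i := by
      intro k hk
      simp only [Finset.mem_biUnion, Finset.mem_filter, Finset.mem_univ, true_and]
      exact ⟨g k, Finset.mem_image_of_mem g hk, (hg k hk).1⟩
    have h2 := (Finset.card_le_card h1).trans Finset.card_biUnion_le
    have h3 : ∀ i, (Finset.univ.filter fun k => Covers f (y k) i).card =
      zeroCount (labelled f y) i := fun i => rfl
    simp only [h3] at h2
    exact_mod_cast h2
  have hsum : ∑ i ∈ I, pickProb m f y i = (∑ i ∈ I, (zeroCount (labelled f y) i : ℝ)) / m := by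
    rw [Finset.sum_div]
    rfl
  have hIcard : (I.card : ℝ) ≤ ((r + 1 : ℕ) : ℝ) := by
    have h1 : I.card ≤ K.card := Finset.card_image_le
    have h2 : K.card ≤ r + 1 := (Finset.card_le_univ K).trans (by simp)
    exact_mod_cast h1.trans h2
  have hup : ∑ i ∈ I, (zeroCount (labelled f y) i : ℝ) ≤ ((r + 1 : ℕ) : ℝ) ^ 2 := by
    refine (Finset.sum_le_sum (g := fun _ => ((r + 1 : ℕ) : ℝ)) fun i _ => ?_).trans ?_
    · exact_mod_cast zeroCount_le _ i
    · rw [Finset.sum_const, nsmul_eq_mul, sq]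
      exact mul_le_mul_of_nonneg_right hIcard (by positivity)
  have hhit := le_prodExp_of_hit (pickProb m f y) (pickProb_nonneg m f y)
    (fun v => (pickProb_le hm hr2 f y v).trans (by norm_num)) I (valInd f false)
    (valInd_nonneg f false) (valInd_le_one f false) (1 / 2) (fun i hi => by
      obtain ⟨k, hk, rfl⟩ := Finset.mem_image.1 hi
      rw [prodExp_valInd_false]
      have := (hg k hk).2
      rw [escapeProb] at this
      linarith)
  rw [hsum] at hhit
  set L := ∑ i ∈ I, (zeroCount (labelled f y) i : ℝ)
  have h1 : L / m ≤ 1 / 4 := by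
    rw [div_le_iff₀ hm']
    linarith
  have h0 : 0 ≤ L / m := by
    have : (0 : ℝ) ≤ K.card := by positivity
    exact div_nonneg (by linarith) hm'.le
  calc (K.card : ℝ) / (4 * m) = K.card / m / 4 := by field_simp
    _ ≤ L / m / 4 := by gcongr
    -- Uses `L / m ≤ 1/4`, the reason for requiring `m ≥ 4 (r + 1)²`.
    _ ≤ 1 / 2 * (L / m) - (L / m) ^ 2 := by nlinarith
    _ ≤ _ := hhit

/-! ### Soundness: a far function fails one of the tests -/

lemma certAcc_le_one {r : ℕ} {m : ℕ} (t : ℕ) (hm : 0 < m) (hr : r ≤ m) (f : BoolFun n)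
    (y : Fin r → Cube n) (x : Cube n) : certAcc m t f y x ≤ 1 := by
  rw [certAcc]
  split_ifs with h1 h2
  · exact le_rfl
  · refine (prodExp_mono (pickProb_nonneg m f y) (pickProb_le (c := 1) hm ?_ f y)
      fun z => valInd_le_one f false _).trans (prodExp_const _ 1).le
    rw [one_mul]
    exact_mod_cast hr
  · exact zero_le_one

open Classical in
lemma isFar_sum_le {ε : ℝ} {D : PMF (Cube n)} {f : BoolFun n} (hfar : IsFar ε D f (Mconj n))
    (S : Finset (Fin n)) :
    ε ≤ ∑ z, (D z).toReal * if (f z = true ↔ ∀ i ∈ S, z i = true) then 0 else 1 := by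
  set g : BoolFun n := fun z => decide (∀ i ∈ S, z i = true) with hg
  have h1 : ENNReal.ofReal ε ≤ distFun D f g :=
    hfar.trans (iInf₂_le g ⟨S, fun z => by simp [hg]⟩)
  have hne : distFun D f g ≠ ⊤ := by
    rw [distFun]
    exact ENNReal.sum_ne_top.2 fun z _ => PMF.apply_ne_top _ _
  rw [ENNReal.ofReal_le_iff_le_toReal hne, distFun,
    ENNReal.toReal_sum fun z _ => PMF.apply_ne_top _ _, Finset.sum_filter] at h1
  refine h1.trans (Finset.sum_le_sum fun z _ => ?_)
  have h2 : (f z ≠ g z) ↔ ¬ (f z = true ↔ ∀ i ∈ S, z i = true) := by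
    rw [hg, ne_eq, Bool.eq_iff_iff]
    simp
  by_cases h : f z = true ↔ ∀ i ∈ S, z i = true
  · rw [if_neg (by rw [h2]; exact not_not.2 h), if_pos h, mul_zero]
  · rw [if_pos (h2.2 h), if_neg h, mul_one]

-- The competing conjunction depends on `y`. If `f z = 0` but the conjunction is `1` at `z`, any
-- certified zero of `z` lies outside its index set and escapes with probability above `1/16`;
-- without a certified zero the test rejects outright.
open Classical in
lemma isFar_le_meets_add {ε : ℝ} {D : PMF (Cube n)} {f : BoolFun n}
    (hfar : IsFar ε D f (Mconj n)) {r m : ℕ} (t : ℕ) (hm : 0 < m) (hr : r ≤ m)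
    (y : Fin r → Cube n) :
    ε ≤ ∑ z, (D z).toReal * (if Meets m f y z then 1 else 0) +
      16 * (1 - ∑ z, (D z).toReal * certAcc m t f y z) := by
  refine (isFar_sum_le hfar (Finset.univ.filter fun i => escapeProb m f y i ≤ 1 / 16)).trans ?_
  have h1 : 16 * (1 - ∑ z, (D z).toReal * certAcc m t f y z) =
      ∑ z, (D z).toReal * (16 * (1 - certAcc m t f y z)) := by
    have h2 : ∀ z, (D z).toReal * (16 * (1 - certAcc m t f y z)) =
        16 * (D z).toReal - 16 * ((D z).toReal * certAcc m t f y z) := fun z => by ring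
    simp only [h2]
    rw [Finset.sum_sub_distrib, ← Finset.mul_sum, ← Finset.mul_sum, sum_toReal]
    ring
  rw [h1, ← Finset.sum_add_distrib]
  refine Finset.sum_le_sum fun z _ => ?_
  rw [← mul_add]
  refine mul_le_mul_of_nonneg_left ?_ ENNReal.toReal_nonneg
  have hle := certAcc_le_one t hm hr f y z
  split_ifs with h2 h3 h3
  · linarith
  · linarith
  · linarith
  · by_cases hz : f z = true
    · refine absurd ?_ h3
      simp only [hz, true_iff, Finset.mem_filter, Finset.mem_univ, true_and] at h2
      push Not at h2
      obtain ⟨i, hi, hzi⟩ := h2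
      exact ⟨i, ⟨hz, by simpa using hzi⟩, hi⟩
    · rw [certAcc, if_neg hz]
      split_ifs with h4
      · obtain ⟨h5, h6, h7⟩ := h4
        rw [prodExp_valInd_false f (pickProb m f y)
          fun z' => Function.update z' ⟨searchResult f z t 0, h5⟩ false]
        have h8 : ¬ escapeProb m f y ⟨searchResult f z t 0, h5⟩ ≤ 1 / 16 := fun h8 =>
          h2 (iff_of_false hz fun h9 => by
            rw [h9 _ (Finset.mem_filter.2 ⟨Finset.mem_univ _, h8⟩)] at h6
            exact Bool.noConfusion h6)
        rw [escapeProb] at h8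
        linarith
      · norm_num

/-- With `x = k / s ≤ 1`: `(1 - ρ)^M ≤ exp (-x) ≤ 1 / (1 + x) ≤ 1 - x / 2`. -/
lemma one_sub_pow_le {ρ k s m : ℝ} {M : ℕ} (hs : 0 < s) (hm : 0 < m) (hk : 0 ≤ k) (hks : k ≤ s)
    (hρ : k / (4 * m) ≤ ρ) (hρ1 : ρ ≤ 1) (hM : 4 * m ≤ M * s) :
    (1 - ρ) ^ M ≤ 1 - k / (2 * s) := by
  have h1 : (1 - ρ) ^ M ≤ Real.exp (-(k / s)) := by
    calc (1 - ρ) ^ M ≤ Real.exp (-ρ) ^ M :=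
          pow_le_pow_left₀ (by linarith) (Real.one_sub_le_exp_neg ρ) M
      _ = Real.exp (-(M * ρ)) := by rw [← Real.exp_nat_mul]; ring_nf
      _ ≤ Real.exp (-(k / s)) := by
        refine Real.exp_le_exp.2 (neg_le_neg ?_)
        calc k / s = 4 * m / s * (k / (4 * m)) := by field_simp
          _ ≤ M * (k / (4 * m)) := by
            refine mul_le_mul_of_nonneg_right ?_ (by positivity)
            rwa [div_le_iff₀ hs]
          _ ≤ M * ρ := by gcongr
  refine h1.trans ?_
  have h2 : k / (2 * s) = k / s / 2 := by field_simp
  rw [h2]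
  have h0 : 0 ≤ k / s := by positivity
  have h3 : k / s ≤ 1 := (div_le_one hs).2 hks
  set x := k / s
  have h4 := Real.add_one_le_exp x
  have h5 : Real.exp (-x) * Real.exp x = 1 := by rw [← Real.exp_add]; simp
  have h6 := Real.exp_pos (-x)
  have h7 : Real.exp (-x) * (x + 1) ≤ 1 := by nlinarith
  nlinarith

open Classical in
/-- If independent samples are likely to meet each other, the union test is likely to reject. -/
lemma acc_unionTest_le {ε : ℝ} {r m M : ℕ} [NeZero m] (hr : 4 * ((r + 1 : ℕ) : ℝ) ^ 2 ≤ m)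
    (hnm : 400 * (n : ℝ) ≤ ε * (r + 1 : ℕ) * m) (hM : 4 * (m : ℝ) ≤ M * (r + 1 : ℕ))
    (f : BoolFun n) (D : PMF (Cube n))
    (h : ε / 2 ≤ expSamples D r fun y => ∑ z, (D z).toReal * if Meets m f y z then 1 else 0) :
    acc f D (unionTest (r + 1) m M) ≤ 1 - ε / 8 := by
  have hm : 0 < m := NeZero.pos m
  have hm' : (0 : ℝ) < m := by exact_mod_cast hm
  have hs : (0 : ℝ) < ((r + 1 : ℕ) : ℝ) := by positivity
  have hrm : r + 1 ≤ m := by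
    have : ((r + 1 : ℕ) : ℝ) ≤ m := by
      have : (1 : ℝ) ≤ ((r + 1 : ℕ) : ℝ) := by exact_mod_cast Nat.le_add_left 1 r
      nlinarith
    exact_mod_cast this
  set s : ℝ := ((r + 1 : ℕ) : ℝ) with hsdef
  have hpoint : ∀ y : Fin (r + 1) → Cube n,
      (1 - prodExp (pickProb m f y) (valInd f false)) ^ M ≤
        (1 + ε / 8) + (∑ k : Fin (r + 1),
          if Meets m f (fun j => y (k.succAbove j)) (y k) then (1 : ℝ) else 0) *
            (-(1 / (2 * s))) := by
    intro y
    set A := Finset.univ.filter fun k : Fin (r + 1) =>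
      Meets m f (fun j => y (k.succAbove j)) (y k) with hA
    set B := Finset.univ.filter fun k : Fin (r + 1) => ¬ 100 * rarity f y k ≤ m with hB
    have hKle : (((A \ B).card : ℕ) : ℝ) ≤ s := by
      have : (A \ B).card ≤ r + 1 := (Finset.card_le_univ _).trans (by simp)
      rw [hsdef]
      exact_mod_cast this
    have hK := card_le_of_meets hm hr f y (A \ B) (fun k hk => by
      simpa [hA, hB] using hk)
    have hone : prodExp (pickProb m f y) (valInd f false) ≤ 1 :=
      (prodExp_mono (pickProb_nonneg m f y)
        (pickProb_le (c := 1) hm (by rw [one_mul]; exact_mod_cast hrm) f y)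
        (valInd_le_one f false)).trans (prodExp_const _ 1).le
    refine (one_sub_pow_le hs hm' (Nat.cast_nonneg _) hKle hK hone hM).trans ?_
    have hAc : (∑ k : Fin (r + 1),
        if Meets m f (fun j => y (k.succAbove j)) (y k) then (1 : ℝ) else 0) = A.card := by
      rw [Finset.sum_boole]
    -- Markov's inequality for the rarities: at most `100 n / m` samples are discarded, half the
    -- guaranteed expected number `ε s / 2` of meeting samples.
    have hBc : (B.card : ℝ) ≤ ε * s / 4 := by
      have h1 : (B.card : ℝ) * (m / 100) ≤ n := by
        refine le_trans ?_ (sum_rarity_le f y)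
        have h2 : (B.card : ℝ) * (m / 100) = ∑ k ∈ B, (m / 100 : ℝ) := by simp
        rw [h2]
        refine (Finset.sum_le_sum fun k hk => ?_).trans
          (Finset.sum_le_sum_of_subset_of_nonneg (Finset.subset_univ B) fun k _ _ => ?_)
        · have := (Finset.mem_filter.1 hk).2
          linarith
        · unfold rarity
          exact Finset.sum_nonneg fun v _ => by split_ifs <;> positivity
      by_contra hcon
      push Not at hcon
      nlinarith
    have hAB : (A.card : ℝ) ≤ ((A \ B).card : ℝ) + B.card := by
      exact_mod_cast Finset.card_le_card_sdiff_add_card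
    rw [hAc]
    have h3 : ((A \ B).card : ℝ) / (2 * s) ≥ (A.card - ε * s / 4) / (2 * s) := by
      gcongr
      linarith
    have h4 : (A.card - ε * s / 4) / (2 * s) = A.card * (1 / (2 * s)) - ε / 8 := by
      field_simp
      ring
    linarith
  rw [acc_unionTest (r + 1) m M hrm]
  refine (expSamples_mono hpoint).trans ?_
  rw [expSamples_add, expSamples_const, expSamples_mul_const, expSamples_sum]
  -- Drawing the `k`-th sample separately makes it a fresh sample against the `r` others.
  have hk : ∀ k : Fin (r + 1), ε / 2 ≤ expSamples D (r + 1) fun y =>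
      if Meets m f (fun j => y (k.succAbove j)) (y k) then (1 : ℝ) else 0 := by
    intro k
    rw [expSamples_succ D r k]
    refine h.trans (le_of_eq ?_)
    simp only [Fin.insertNth_apply_same, Fin.insertNth_apply_succAbove, expSamples_sum]
    refine Finset.sum_congr rfl fun z _ => ?_
    have := expSamples_mul_const D r (fun y => if Meets m f y z then (1 : ℝ) else 0) (D z).toReal
    simp only [mul_comm _ (D z).toReal] at this
    exact this
  have hsum : s * (ε / 2) ≤ ∑ k : Fin (r + 1), expSamples D (r + 1) fun y =>
      if Meets m f (fun j => y (k.succAbove j)) (y k) then (1 : ℝ) else 0 := by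
    refine le_trans (le_of_eq ?_) (Finset.sum_le_sum fun k _ => hk k)
    simp [hsdef]
  have h5 : s * (ε / 2) * (1 / (2 * s)) = ε / 4 := by field_simp; ring
  have h6 := mul_le_mul_of_nonneg_right hsum (by positivity : (0 : ℝ) ≤ 1 / (2 * s))
  linarith

lemma acc_tester_of_isFar {ε : ℝ} {r m t M R : ℕ} [NeZero m] (hε0 : 0 < ε)
    (hr : 4 * ((r + 1 : ℕ) : ℝ) ^ 2 ≤ m)
    (hnm : 400 * (n : ℝ) ≤ ε * (r + 1 : ℕ) * m) (hM : 4 * (m : ℝ) ≤ M * (r + 1 : ℕ))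
    (hR : 64 ≤ R * ε) {f : BoolFun n} {D : PMF (Cube n)} (hfar : IsFar ε D f (Mconj n)) :
    acc f D (tester r m t M R) ≤ 1 / 3 := by
  classical
  have hm : 0 < m := NeZero.pos m
  have hrm : r ≤ m := by
    have : (r : ℝ) ≤ m := by
      push_cast at hr
      have : (0 : ℝ) ≤ r := Nat.cast_nonneg r
      nlinarith
    exact_mod_cast this
  have hpow : ∀ a : ℝ, 0 ≤ a → a ≤ 1 - ε / 32 → a ^ R ≤ 1 / 3 := by
    intro a ha0 ha
    calc a ^ R ≤ Real.exp (-(ε / 32)) ^ R :=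
          pow_le_pow_left₀ ha0 (ha.trans (Real.one_sub_le_exp_neg _)) R
      _ = Real.exp (-(R * ε / 32)) := by rw [← Real.exp_nat_mul]; ring_nf
      _ ≤ Real.exp (-2) := Real.exp_le_exp.2 (by linarith)
      _ ≤ 1 / 3 := by
        rw [Real.exp_neg, one_div]
        exact inv_anti₀ (by norm_num) (by linarith [Real.add_one_le_exp 2])
  -- A certificate rejection probability below `ε/32` uses up less than `16 · ε/32 = ε/2` of the
  -- distance, leaving at least `ε/2` for `Meets`.
  have hmain : acc f D (certTest r m t) ≤ 1 - ε / 32 ∨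
      acc f D (unionTest (r + 1) m M) ≤ 1 - ε / 32 := by
    by_contra! hcon
    obtain ⟨h1, h2⟩ := hcon
    have h3 := expSamples_mono (D := D) fun y => isFar_le_meets_add hfar t hm hrm y
    rw [expSamples_const, expSamples_add] at h3
    have h4 : (fun y : Fin r → Cube n => 16 * (1 - ∑ z, (D z).toReal * certAcc m t f y z)) =
        fun y => 16 + (∑ z, (D z).toReal * certAcc m t f y z) * (-16) := by
      funext y
      ring
    rw [h4, expSamples_add, expSamples_const, expSamples_mul_const,
      ← acc_certTest r m t hrm] at h3
    have h5 := acc_unionTest_le hr hnm hM f D (by linarith)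
    linarith
  rw [tester, acc_seq, acc_iter, acc_iter]
  have a0 := pow_nonneg (acc_nonneg f D (certTest r m t)) R
  have b0 := pow_nonneg (acc_nonneg f D (unionTest (r + 1) m M)) R
  have a1 := pow_le_one₀ (n := R) (acc_nonneg f D (certTest r m t)) (acc_le_one f D _)
  have b1 := pow_le_one₀ (n := R) (acc_nonneg f D (unionTest (r + 1) m M)) (acc_le_one f D _)
  rcases hmain with h | h
  · have := hpow _ (acc_nonneg _ _ _) h
    nlinarith
  · have := hpow _ (acc_nonneg _ _ _) h
    nlinarith

end OracleAlg

/-! ### Choice of parameters and query count -/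

/-- The parameter `r` of the tester, of order `n ^ (1 / 3)`. -/
def sampleCount (n : ℕ) : ℕ := ⌊(n : ℝ) ^ (1 / 3 : ℝ)⌋₊

/-- The parameter `m` of the tester. -/
def thresholdCount (n : ℕ) (ε : ℝ) : ℕ := ⌈400 * (n : ℝ) / (ε * (sampleCount n + 1 : ℕ))⌉₊ + 1

instance (n : ℕ) (ε : ℝ) : NeZero (thresholdCount n ε) := ⟨Nat.succ_ne_zero _⟩

/-- The number of random combinations tested by the tester. -/
def combinationCount (n : ℕ) (ε : ℝ) : ℕ :=
  ⌈4 * (thresholdCount n ε : ℝ) / (sampleCount n + 1 : ℕ)⌉₊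

/-- The tester for monotone conjunctions. -/
def mconjTester (n : ℕ) (ε : ℝ) : OracleAlg n :=
  OracleAlg.tester (sampleCount n) (thresholdCount n ε) (3 * (sampleCount n + 1))
    (combinationCount n ε) ⌈64 / ε⌉₊

lemma rpow_third_pow (n : ℕ) : ((n : ℝ) ^ (1 / 3 : ℝ)) ^ 3 = n := by
  rw [← Real.rpow_natCast, ← Real.rpow_mul (Nat.cast_nonneg n)]
  norm_num

lemma one_le_rpow_third {n : ℕ} (hn : 1 ≤ n) : 1 ≤ (n : ℝ) ^ (1 / 3 : ℝ) :=
  Real.one_le_rpow (by exact_mod_cast hn) (by norm_num)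

lemma le_sampleCount_succ (n : ℕ) :
    (n : ℝ) ^ (1 / 3 : ℝ) ≤ ((sampleCount n + 1 : ℕ) : ℝ) := by
  push_cast
  exact (Nat.lt_floor_add_one _).le

lemma sampleCount_succ_le {n : ℕ} (hn : 1 ≤ n) :
    ((sampleCount n + 1 : ℕ) : ℝ) ≤ 2 * (n : ℝ) ^ (1 / 3 : ℝ) := by
  have h1 := one_le_rpow_third hn
  have h2 : (sampleCount n : ℝ) ≤ (n : ℝ) ^ (1 / 3 : ℝ) := Nat.floor_le (by linarith)
  push_cast
  linarith

/-- A search depth of order `n^(1/3)` rather than `log n` already fits the query budget, and avoids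
logarithms. -/
lemma le_two_pow_sampleCount (n : ℕ) : n ≤ 2 ^ (3 * (sampleCount n + 1)) := by
  have h1 : (n : ℝ) ≤ ((sampleCount n + 1 : ℕ) : ℝ) ^ 3 := by
    rw [← rpow_third_pow n]
    exact pow_le_pow_left₀ (by positivity) (le_sampleCount_succ n) 3
  have h2 : n ≤ (sampleCount n + 1) ^ 3 := by exact_mod_cast h1
  rw [mul_comm, pow_mul]
  exact h2.trans (Nat.pow_le_pow_left Nat.lt_two_pow_self.le 3)

lemma le_thresholdCount {n : ℕ} {ε : ℝ} (hε : 0 < ε) :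
    400 * (n : ℝ) ≤ ε * (sampleCount n + 1 : ℕ) * thresholdCount n ε := by
  have h1 : 400 * (n : ℝ) / (ε * (sampleCount n + 1 : ℕ)) ≤ thresholdCount n ε := by
    rw [thresholdCount]
    push_cast
    exact (Nat.le_ceil _).trans (by linarith)
  rw [div_le_iff₀ (by positivity)] at h1
  linarith

/-- For `s = r + 1`, `s³ ≤ 8 n`, while `s * m ≥ 400 n` because `ε ≤ 1`. -/
lemma sq_le_thresholdCount {n : ℕ} {ε : ℝ} (hn : 1 ≤ n) (hε : 0 < ε) (hε1 : ε ≤ 1) :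
    4 * ((sampleCount n + 1 : ℕ) : ℝ) ^ 2 ≤ thresholdCount n ε := by
  have h1 := le_thresholdCount (n := n) hε
  have h2 := sampleCount_succ_le hn
  have hs : (0 : ℝ) < ((sampleCount n + 1 : ℕ) : ℝ) := by positivity
  set s : ℝ := ((sampleCount n + 1 : ℕ) : ℝ)
  have h3 : s ^ 3 ≤ (2 * (n : ℝ) ^ (1 / 3 : ℝ)) ^ 3 := pow_le_pow_left₀ hs.le h2 3
  rw [mul_pow, rpow_third_pow] at h3
  have h4 : ε * s * thresholdCount n ε ≤ s * thresholdCount n ε := by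
    refine mul_le_mul_of_nonneg_right ?_ (Nat.cast_nonneg _)
    nlinarith
  have h5 : 4 * s ^ 2 * s ≤ thresholdCount n ε * s := by nlinarith
  exact le_of_mul_le_mul_right h5 hs

lemma le_combinationCount (n : ℕ) (ε : ℝ) :
    4 * (thresholdCount n ε : ℝ) ≤ combinationCount n ε * (sampleCount n + 1 : ℕ) := by
  rw [← div_le_iff₀ (by positivity)]
  exact Nat.le_ceil _

lemma combinationCount_le {n : ℕ} {ε : ℝ} (hn : 1 ≤ n) (hε : 0 < ε) (hε1 : ε ≤ 1) :
    (combinationCount n ε : ℝ) ≤ 1609 * ((n : ℝ) ^ (1 / 3 : ℝ) / ε) := by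
  have hc := one_le_rpow_third hn
  have hs := le_sampleCount_succ n
  have hn3 := rpow_third_pow n
  set c := (n : ℝ) ^ (1 / 3 : ℝ)
  have hc0 : 0 < c := by linarith
  have hm : (thresholdCount n ε : ℝ) ≤ 402 * (c ^ 2 / ε) := by
    have h1 : 400 * (n : ℝ) / (ε * (sampleCount n + 1 : ℕ)) ≤ 400 * (c ^ 2 / ε) := by
      calc 400 * (n : ℝ) / (ε * (sampleCount n + 1 : ℕ)) ≤ 400 * (n : ℝ) / (ε * c) := by
            gcongr
        _ = 400 * (c ^ 2 / ε) := by
            rw [← hn3]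
            field_simp
    have h2 : 1 ≤ c ^ 2 / ε := by
      rw [le_div_iff₀ hε]
      nlinarith
    rw [thresholdCount]
    push_cast at h1 ⊢
    have h3 := Nat.ceil_lt_add_one
      (show 0 ≤ 400 * (n : ℝ) / (ε * ((sampleCount n : ℝ) + 1)) by positivity)
    linarith
  have h1 : 4 * (thresholdCount n ε : ℝ) / (sampleCount n + 1 : ℕ) ≤ 1608 * (c / ε) := by
    calc 4 * (thresholdCount n ε : ℝ) / (sampleCount n + 1 : ℕ)
        ≤ 4 * (402 * (c ^ 2 / ε)) / c := by gcongr
      _ = 1608 * (c / ε) := by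
          field_simp
          norm_num
  have h2 : 1 ≤ c / ε := by
    rw [le_div_iff₀ hε]
    linarith
  have h3 := Nat.ceil_lt_add_one
    (show 0 ≤ 4 * (thresholdCount n ε : ℝ) / (sampleCount n + 1 : ℕ) by positivity)
  rw [combinationCount]
  linarith

lemma queries_mconjTester_le {n : ℕ} {ε : ℝ} (hn : 1 ≤ n) (hε : 0 < ε) (hε1 : ε ≤ 1) :
    ((mconjTester n ε).queries : ℝ) ≤ 105365 * ((n : ℝ) ^ (1 / 3 : ℝ) / ε ^ 2) := by
  have h1 : ((mconjTester n ε).queries : ℝ) ≤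
      ⌈64 / ε⌉₊ * (5 * ((sampleCount n + 1 : ℕ) : ℝ) + 2 + combinationCount n ε) := by
    have := OracleAlg.queries_tester_le (n := n) (sampleCount n) (thresholdCount n ε)
      (3 * (sampleCount n + 1)) (combinationCount n ε) ⌈64 / ε⌉₊
    refine (Nat.cast_le.2 this).trans (le_of_eq ?_)
    push_cast
    ring
  have hM := combinationCount_le hn hε hε1
  have hs := sampleCount_succ_le hn
  have hc := one_le_rpow_third hn
  set c := (n : ℝ) ^ (1 / 3 : ℝ)
  have hR : (⌈64 / ε⌉₊ : ℝ) ≤ 65 / ε := by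
    have h2 := Nat.ceil_lt_add_one (show 0 ≤ 64 / ε by positivity)
    have h3 : 1 ≤ 1 / ε := by rwa [le_div_iff₀ hε, one_mul]
    have h4 : 65 / ε = 64 / ε + 1 / ε := by ring
    linarith
  have hcε : c ≤ c / ε := by
    rw [le_div_iff₀ hε]
    nlinarith
  calc ((mconjTester n ε).queries : ℝ)
      ≤ ⌈64 / ε⌉₊ * (5 * ((sampleCount n + 1 : ℕ) : ℝ) + 2 + combinationCount n ε) := h1
    _ ≤ 65 / ε * (1621 * (c / ε)) := by
        refine mul_le_mul hR ?_ (by positivity) (by positivity)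
        linarith
    _ = 105365 * (c / ε ^ 2) := by
        field_simp
        norm_num

/-- Since `n / ε ≥ 2`, the logarithm is at least `1/2`, so its seventh power loses at most `2^7 =
128`. -/
lemma query_bound {n : ℕ} {ε : ℝ} (hn : 2 ≤ n) (hε : 0 < ε) (hε1 : ε ≤ 1) :
    (n : ℝ) ^ (1 / 3 : ℝ) / ε ^ 2 ≤
      128 * (((n : ℝ) ^ (1 / 3 : ℝ) / ε ^ 5) * Real.log ((n : ℝ) / ε) ^ 7) := by
  have hn' : (2 : ℝ) ≤ n := by exact_mod_cast hn
  have hlog : 1 / 2 ≤ Real.log ((n : ℝ) / ε) := by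
    have h1 : (2 : ℝ) ≤ n / ε := by
      rw [le_div_iff₀ hε]
      nlinarith
    have h2 := Real.log_le_log (by norm_num) h1
    linarith [Real.log_two_gt_d9]
  have h7 : (1 / 2 : ℝ) ^ 7 ≤ Real.log ((n : ℝ) / ε) ^ 7 :=
    pow_le_pow_left₀ (by norm_num) hlog 7
  have h5 : (n : ℝ) ^ (1 / 3 : ℝ) / ε ^ 2 ≤ (n : ℝ) ^ (1 / 3 : ℝ) / ε ^ 5 :=
    div_le_div_of_nonneg_left (by positivity) (by positivity)
      (pow_le_pow_of_le_one hε.le hε1 (by norm_num))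
  have h0 : 0 ≤ (n : ℝ) ^ (1 / 3 : ℝ) / ε ^ 5 := by positivity
  norm_num at h7
  nlinarith

end

theorem theorem1 :
    ∃ (T : (n : ℕ) → ℝ → OracleAlg n) (C : ℝ),
      ∀ (n : ℕ) (ε : ℝ), 2 ≤ n → 0 < ε → ε ≤ 1 →
        (T n ε).IsTester (Mconj n) ε ∧
        (T n ε).IsOneSided (Mconj n) ∧
        ((T n ε).queries : ℝ) ≤
          C * (((n : ℝ) ^ (1 / 3 : ℝ) / ε ^ 5) * Real.log ((n : ℝ) / ε) ^ 7) := by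
  refine ⟨mconjTester, 105365 * 128, fun n ε hn hε hε1 => ?_⟩
  have hn1 : 1 ≤ n := by omega
  have hone : (mconjTester n ε).IsOneSided (Mconj n) := by
    intro f hf D
    refine OracleAlg.run_true_eq_one_of_acc (OracleAlg.acc_tester_of_mem hf D _ _ _ _ _ ?_
      (le_two_pow_sampleCount n))
    have h1 := sq_le_thresholdCount hn1 hε hε1
    have h2 : (sampleCount n : ℝ) ≤ thresholdCount n ε := by
      push_cast at h1
      have : (0 : ℝ) ≤ sampleCount n := Nat.cast_nonneg _
      nlinarith
    exact_mod_cast h2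
  refine ⟨⟨fun f hf D => ?_, fun f D hfar => ?_⟩, hone, ?_⟩
  · rw [hone f hf D]
    exact ENNReal.div_le_of_le_mul (by norm_num)
  · refine OracleAlg.le_run_false_of_acc (OracleAlg.acc_tester_of_isFar hε
      (sq_le_thresholdCount hn1 hε hε1) (le_thresholdCount hε) (le_combinationCount n ε) ?_ hfar)
    rw [← div_le_iff₀ hε]
    exact Nat.le_ceil _
  · refine (queries_mconjTester_le hn1 hε hε1).trans ?_
    rw [mul_assoc]
    exact mul_le_mul_of_nonneg_left (query_bound hn hε hε1) (by norm_num)
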